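/- Let $(X,\mathcal F,\mu)$ be a finite positive measure space and let $\{\psi_{j,k}: j,k=1,2,\dots\}$ be an orthonormal system of real-valued functions in $L^2=L^2(X,\mathcal F,\mu)$. Let $\{c_{j,k}: j,k=1,2,\dots\}$ be real numbers such that $$\sum_{j=1}^{\infty}\sum_{k=1}^{\infty} c_{j,k}^2\,[\log\log(j+3)]^2\,[\log\log(k+3)]^2<\infty,$$ where the logarithms are to the base $2$, and let $s_{m,n}(x)=\sum_{j=1}^{m}\sum_{k=1}^{n}c_{j,k}\psi_{j,k}(x)$ $(m,n=1,2,\dots)$ be the rectangular partial sums of the double orthogonal series $\sum_{j}\sum_{k}c_{j,k}\psi_{j,k}$. Then this series has a sum $g\in L^2$ in the $L^2$-norm, that is, $\int_X|s_{m,n}-g|^2\,d\mu\to0$ as $m,n\to\infty$, and for every such $g$ the series is strongly Cesàro $|C,1,1|$ summable to $g$ almost everywhere, that is, $$\frac1{MN}\sum_{m=1}^{M}\sum_{n=1}^{N}|s_{m,n}(x)-g(x)|^2\to0\quad\text{for almost every }x\in X\text{ as }M,N\to\infty.$$ Here $m,n\to\infty$ and $M,N\to\infty$ are meant in Pringsheim's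 sense: $\min(m,n)\to\infty$ and $\min(M,N)\to\infty$. -/

import Mathlib

open MeasureTheory Filter Topology

/-- `ψ = {ψ_{j,k} : j, k = 1, 2, …}` is a (double) orthonormal system of real-valued functions in
`L²(X, μ)`. -/
structure IsDoubleONS {X : Type*} [MeasurableSpace X] (μ : Measure X)
    (ψ : ℕ+ → ℕ+ → X → ℝ) : Prop where
  memLp : ∀ j k, MemLp (ψ j k) 2 μ
  integral_sq : ∀ j k, ∫ x, ψ j k x ^ 2 ∂μ = 1
  integral_mul : ∀ j k j' k', (j, k) ≠ (j', k') → ∫ x, ψ j k x * ψ j' k' x ∂μ = 0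

/-- The rectangular partial sums `s_{m,n}(x) = ∑_{j=1}^m ∑_{k=1}^n c_{j,k} ψ_{j,k}(x)`. -/
def rectPartialSum {X : Type*} (c : ℕ+ → ℕ+ → ℝ) (ψ : ℕ+ → ℕ+ → X → ℝ)
    (m n : ℕ+) (x : X) : ℝ :=
  ∑ j ∈ Finset.Icc 1 m, ∑ k ∈ Finset.Icc 1 n, c j k * ψ j k x

/-- `g ∈ L²(X, μ)` is the sum of the double series `∑ c_{j,k} ψ_{j,k}` in the `L²`-norm:
`∫ |s_{m,n} - g|² dμ → 0` as `m, n → ∞`. (`atTop` on `ℕ+ × ℕ+` means `min (m, n) → ∞`.) -/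
def IsL2Sum {X : Type*} [MeasurableSpace X] (μ : Measure X)
    (c : ℕ+ → ℕ+ → ℝ) (ψ : ℕ+ → ℕ+ → X → ℝ) (g : X → ℝ) : Prop :=
  MemLp g 2 μ ∧
    Tendsto (fun p : ℕ+ × ℕ+ => ∫ x, |rectPartialSum c ψ p.1 p.2 x - g x| ^ 2 ∂μ) atTop (𝓝 0)

/-- `log log (j + 3)`, logarithms to the base 2. -/
noncomputable def logLog (j : ℕ+) : ℝ :=
  Real.logb 2 (Real.logb 2 ((j : ℝ) + 3))

/-- The double sequence `s_{m,n}` of real numbers is strongly Cesàro `|C,1,1|` summable to `t`: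
`(1/(MN)) ∑_{m=1}^M ∑_{n=1}^N |s_{m,n} - t|² → 0` as `M, N → ∞`, in Pringsheim's sense. -/
def StronglyCesaroSummable (s : ℕ+ → ℕ+ → ℝ) (t : ℝ) : Prop :=
  Tendsto (fun P : ℕ+ × ℕ+ =>
    1 / ((P.1 : ℝ) * (P.2 : ℝ)) *
      ∑ m ∈ Finset.Icc 1 P.1, ∑ n ∈ Finset.Icc 1 P.2, |s m n - t| ^ 2) atTop (𝓝 0)

/-! The core is a deterministic inequality: for one fixed family of weights `W` on finite sets,
every real sequence satisfies (1/N) ∑_{n<N} |S_n|² ≤ ∑_I W_I (∑_{k∈I} a_k)² for all N at once, and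
the total weight of the sets containing k is O((log log k)²) (`exists_weight_cesaro_le`). It comes
from S_n = S_{2^r} + remainder. The sums S_{2^r} are controlled by a Rademacher–Menshov inequality
in the exponent r, which costs (log r)², about (log log k)². The remainders cost O(1) after
averaging.

Since the inequality holds for arbitrary real sequences and its right side is a sum of squares, it
can be applied in each variable in turn (`double_cesaro_le`). Integration then only uses
orthogonality: the two-variable majorant has integral ∑ load(j) load(k) c_{jk}²
(`lintegral_doubleSquareSum`), which the hypothesis makes finite.

Deleting the coefficients in a K×K square makes this integral tend to 0, and so does ∫|s_{K,K} -
g|². By Fatou, for almost every x some K makes both integrands small at x. For that K, the means of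
|s_{m,n}(x) - g(x)|² are small up to the terms with m < K or n < K, whose proportion vanishes
(`eventually_cesaro_le`). -/

/-! ### Weighted sums of squares and their loads -/

/-- The weighted sum of squares `∑_I W_I (∑_{k ∈ I} a_k)²`. -/
noncomputable def weightedSquareSum {κ : Type*} (W : Finset κ → ENNReal) (a : κ → ℝ) : ENNReal :=
  ∑' I, W I * ENNReal.ofReal ((∑ k ∈ I, a k) ^ 2)

/-- The total weight `∑_{I ∋ k} W_I` of the sets that contain `k`. -/
noncomputable def weightLoad {κ : Type*} [DecidableEq κ] (W : Finset κ → ENNReal) (k : κ) : ENNReal :=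
  ∑' I, if k ∈ I then W I else 0

open Classical in
/-- The weights on finite sets that come from an indexed family of weighted sets. -/
noncomputable def familyWeight {ι κ : Type*} (w : ι → ENNReal) (S : ι → Finset κ) :
    Finset κ → ENNReal :=
  fun I => ∑' i, if I = S i then w i else 0

/-- Coinciding sets have their weights added, so sums over all finite sets can be computed over the
index i instead. -/
lemma tsum_familyWeight_mul {ι κ : Type*} (w : ι → ENNReal) (S : ι → Finset κ)
    (F : Finset κ → ENNReal) :
    ∑' I, familyWeight w S I * F I = ∑' i, w i * F (S i) := by
  classical
  simp only [familyWeight, ← ENNReal.tsum_mul_right]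
  rw [ENNReal.tsum_comm]
  congr 1 with i
  rw [tsum_eq_single (S i) (by intro I hI; simp [hI])]
  simp

lemma weightedSquareSum_familyWeight {ι κ : Type*} (w : ι → ENNReal) (S : ι → Finset κ)
    (a : κ → ℝ) :
    weightedSquareSum (familyWeight w S) a
      = ∑' i, w i * ENNReal.ofReal ((∑ k ∈ S i, a k) ^ 2) :=
  tsum_familyWeight_mul w S fun I => ENNReal.ofReal ((∑ k ∈ I, a k) ^ 2)

lemma weightLoad_eq_tsum_mul {κ : Type*} [DecidableEq κ] (W : Finset κ → ENNReal) (k : κ) :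
    weightLoad W k = ∑' I, W I * (if k ∈ I then 1 else 0) := by
  simp [weightLoad]

lemma weightLoad_familyWeight {ι κ : Type*} [DecidableEq κ] (w : ι → ENNReal) (S : ι → Finset κ) (k : κ) :
    weightLoad (familyWeight w S) k = ∑' i, if k ∈ S i then w i else 0 := by
  rw [weightLoad_eq_tsum_mul, tsum_familyWeight_mul]
  simp

lemma weightedSquareSum_add {κ : Type*} (V W : Finset κ → ENNReal) (a : κ → ℝ) :
    weightedSquareSum (V + W) a = weightedSquareSum V a + weightedSquareSum W a := by
  simp only [weightedSquareSum, Pi.add_apply, add_mul, ENNReal.tsum_add]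

lemma weightLoad_add {κ : Type*} [DecidableEq κ] (V W : Finset κ → ENNReal) (k : κ) :
    weightLoad (V + W) k = weightLoad V k + weightLoad W k := by
  simp only [weightLoad_eq_tsum_mul, Pi.add_apply, add_mul, ENNReal.tsum_add]

lemma weightedSquareSum_smul {κ : Type*} (c : ENNReal) (W : Finset κ → ENNReal) (a : κ → ℝ) :
    weightedSquareSum (fun I => c * W I) a = c * weightedSquareSum W a := by
  simp only [weightedSquareSum, mul_assoc, ENNReal.tsum_mul_left]

lemma weightLoad_smul {κ : Type*} [DecidableEq κ] (c : ENNReal) (W : Finset κ → ENNReal) (k : κ) :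
    weightLoad (fun I => c * W I) k = c * weightLoad W k := by
  simp only [weightLoad_eq_tsum_mul, mul_assoc, ENNReal.tsum_mul_left]

/-! ### The Rademacher–Menshov inequality with weights independent of the length -/

lemma sum_range_two_pow_eq (u : ℕ → ℝ) (K : ℕ) :
    ∑ r ∈ Finset.range (2 ^ K), u r
      = u 0 + ∑ e ∈ Finset.range K, ∑ r ∈ Finset.Ico (2 ^ e) (2 ^ (e + 1)), u r := by
  induction K with
  | zero => simp
  | succ K ih =>
    rw [Finset.sum_range_succ, ← add_assoc, ← ih,
      Finset.sum_range_add_sum_Ico _ (Nat.pow_le_pow_right (by norm_num) (by omega))]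

/-- Clearing the `e`-th binary digit of `R` removes at most one dyadic interval of length `2^e`. -/
lemma sum_range_clear_digit (u : ℕ → ℝ) (R e : ℕ) :
    (∑ r ∈ Finset.range (R / 2 ^ e * 2 ^ e), u r
      - ∑ r ∈ Finset.range (R / 2 ^ (e + 1) * 2 ^ (e + 1)), u r) ^ 2
      ≤ (∑ r ∈ Finset.Ico ((2 * (R / 2 ^ (e + 1))) * 2 ^ e)
          ((2 * (R / 2 ^ (e + 1)) + 1) * 2 ^ e), u r) ^ 2 := by
  have h1 : R / 2 ^ (e + 1) = R / 2 ^ e / 2 := by rw [Nat.div_div_eq_div_mul, pow_succ]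
  have h2 : R / 2 ^ (e + 1) * 2 ^ (e + 1) = 2 * (R / 2 ^ (e + 1)) * 2 ^ e := by ring
  rw [h2]
  rcases Nat.mod_two_eq_zero_or_one (R / 2 ^ e) with h | h
  · have : R / 2 ^ e = 2 * (R / 2 ^ (e + 1)) := by omega
    rw [← this, sub_self, zero_pow two_ne_zero]
    positivity
  · have : R / 2 ^ e = 2 * (R / 2 ^ (e + 1)) + 1 := by omega
    rw [this, Finset.sum_Ico_eq_sub _ (Nat.mul_le_mul_right _ (by omega))]

lemma sum_range_inv_sq_le_two (K : ℕ) :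
    ∑ e ∈ Finset.range K, (((e : ℝ) + 1) ^ 2)⁻¹ ≤ 2 := by
  have h := sum_Ioo_inv_sq_le (α := ℝ) 0 (K + 1)
  have e : Finset.Ioo 0 (K + 1) = Finset.Ico 1 (K + 1) := by ext; simp; omega
  rw [e, Finset.sum_Ico_eq_sum_range] at h
  simpa [add_comm] using h

/-- The Rademacher–Menshov decomposition of an initial sum into dyadic blocks. -/
lemma sq_sum_range_le_dyadic (u : ℕ → ℝ) {R : ℕ} (hR : R ≠ 0) :
    (∑ r ∈ Finset.range R, u r) ^ 2 ≤ 3 * u 0 ^ 2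
      + ∑ e ∈ Finset.range (Nat.log 2 R),
          6 * ((e : ℝ) + 1) ^ 2 * (∑ r ∈ Finset.Ico (2 ^ e) (2 ^ (e + 1)), u r) ^ 2
      + ∑ e ∈ Finset.range (Nat.log 2 R), 3 * (Nat.log 2 R : ℝ) *
          (∑ r ∈ Finset.Ico ((2 * (R / 2 ^ (e + 1))) * 2 ^ e)
            ((2 * (R / 2 ^ (e + 1)) + 1) * 2 ^ e), u r) ^ 2 := by
  set K := Nat.log 2 R with hK
  -- The sum up to R with its last e binary digits cleared: `s 0` is the whole sum, and `s K` stops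
  -- at the leading power 2^K.
  set s : ℕ → ℝ := fun e => ∑ r ∈ Finset.range (R / 2 ^ e * 2 ^ e), u r with hs
  set B : ℕ → ℝ := fun e => ∑ r ∈ Finset.Ico (2 ^ e) (2 ^ (e + 1)), u r with hBdef
  set D : ℕ → ℝ := fun e => ∑ r ∈ Finset.Ico ((2 * (R / 2 ^ (e + 1))) * 2 ^ e)
            ((2 * (R / 2 ^ (e + 1)) + 1) * 2 ^ e), u r with hDdef
  have hdiv : R / 2 ^ K = 1 := by
    have h1 := Nat.pow_log_le_self 2 hR
    have h2 := Nat.lt_pow_succ_log_self (b := 2) one_lt_two R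
    rw [Nat.div_eq_iff (by positivity)]
    rw [← hK] at h1 h2
    rw [pow_succ] at h2
    constructor <;> omega
  have h0 : ∑ r ∈ Finset.range R, u r = s 0 := by simp [hs]
  have hsK : s K = u 0 + ∑ e ∈ Finset.range K, B e := by
    simp only [hs, hdiv, one_mul]
    exact sum_range_two_pow_eq u K
  have htel : s 0 - s K = ∑ e ∈ Finset.range K, (s e - s (e + 1)) :=
    (Finset.sum_range_sub' s K).symm
  have hB : (∑ e ∈ Finset.range K, B e) ^ 2
      ≤ 2 * ∑ e ∈ Finset.range K, ((e : ℝ) + 1) ^ 2 * B e ^ 2 := by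
    -- Cauchy–Schwarz against the summable weights (e+1)⁻² keeps the coefficient of each block
    -- independent of R.
    refine (Finset.sum_sq_le_sum_mul_sum_of_sq_le_mul (Finset.range K)
      (f := fun e => (((e : ℝ) + 1) ^ 2)⁻¹) (g := fun e => ((e : ℝ) + 1) ^ 2 * B e ^ 2)
      (fun _ _ => by positivity) (fun _ _ => by positivity) (fun e _ => ?_)).trans ?_
    · rw [inv_mul_cancel_left₀ (by positivity)]
    · exact mul_le_mul_of_nonneg_right (sum_range_inv_sq_le_two K)
        (Finset.sum_nonneg fun _ _ => by positivity)
  have hD : (∑ e ∈ Finset.range K, (s e - s (e + 1))) ^ 2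
      ≤ K * ∑ e ∈ Finset.range K, (s e - s (e + 1)) ^ 2 := by
    simpa using sq_sum_le_card_mul_sum_sq (s := Finset.range K) (f := fun e => s e - s (e + 1))
  have hD' : ∑ e ∈ Finset.range K, (s e - s (e + 1)) ^ 2 ≤ ∑ e ∈ Finset.range K, D e ^ 2 :=
    Finset.sum_le_sum fun e _ => sum_range_clear_digit u R e
  have hD'' := hD.trans (mul_le_mul_of_nonneg_left hD' K.cast_nonneg)
  have e₁ : ∑ e ∈ Finset.range K, 6 * ((e : ℝ) + 1) ^ 2 * B e ^ 2
      = 6 * ∑ e ∈ Finset.range K, ((e : ℝ) + 1) ^ 2 * B e ^ 2 := by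
    simp only [Finset.mul_sum, mul_assoc]
  have e₂ : ∑ e ∈ Finset.range K, 3 * (K : ℝ) * D e ^ 2
      = 3 * (K * ∑ e ∈ Finset.range K, D e ^ 2) := by
    simp only [Finset.mul_sum, mul_assoc]
  change _ ≤ 3 * u 0 ^ 2 + ∑ e ∈ Finset.range K, 6 * ((e : ℝ) + 1) ^ 2 * B e ^ 2
    + ∑ e ∈ Finset.range K, 3 * (K : ℝ) * D e ^ 2
  rw [e₁, e₂, h0, show s 0 = u 0 + ∑ e ∈ Finset.range K, B e + ∑ e ∈ Finset.range K, (s e - s (e + 1)) by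
    rw [← htel, hsK]; ring]
  set x := u 0
  set y := ∑ e ∈ Finset.range K, B e
  set z := ∑ e ∈ Finset.range K, (s e - s (e + 1))
  have : (x + y + z) ^ 2 ≤ 3 * x ^ 2 + 3 * y ^ 2 + 3 * z ^ 2 := by
    nlinarith [sq_nonneg (x - y), sq_nonneg (x - z), sq_nonneg (y - z)]
  linarith

/-- The Rademacher–Menshov inequality as a pointwise bound by a weighted sum of squares of
interval sums. -/
theorem exists_weight_sq_sum_range_le :
    ∃ W : Finset ℕ → ENNReal,
      (∀ (u : ℕ → ℝ) (R : ℕ),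
        ENNReal.ofReal ((∑ r ∈ Finset.range R, u r) ^ 2) ≤ weightedSquareSum W u) ∧
      ∀ r : ℕ, weightLoad W r ≤ ENNReal.ofReal (12 * ((Nat.log 2 r : ℝ) + 1) ^ 2) := by
  set W₁ : Finset ℕ → ENNReal := familyWeight (fun _ : Unit => ENNReal.ofReal 3) fun _ => {0}
    with hW₁
  set W₂ : Finset ℕ → ENNReal := familyWeight
    (fun e : ℕ => ENNReal.ofReal (6 * ((e : ℝ) + 1) ^ 2)) fun e => Finset.Ico (2 ^ e) (2 ^ (e + 1))
    with hW₂
  -- The factor log R of the decomposition is replaced by e + log t, which depends only on the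
  -- interval [t2^e, (t+1)2^e). The value 0 at t = 0 leaves only the levels e ≤ log r in the load at
  -- r.
  set w : ℕ × ℕ → ENNReal := fun p =>
    if p.2 = 0 then 0 else ENNReal.ofReal (3 * ((p.1 : ℝ) + Nat.log 2 p.2)) with hw
  set W₃ : Finset ℕ → ENNReal := familyWeight w
    (fun p => Finset.Ico (p.2 * 2 ^ p.1) ((p.2 + 1) * 2 ^ p.1)) with hW₃
  refine ⟨W₁ + W₂ + W₃, fun u R => ?_, fun r => ?_⟩
  · rcases eq_or_ne R 0 with rfl | hR
    · simp
    refine (ENNReal.ofReal_le_ofReal (sq_sum_range_le_dyadic u hR)).trans ?_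
    rw [ENNReal.ofReal_add (by positivity) (by positivity),
      ENNReal.ofReal_add (by positivity) (by positivity), weightedSquareSum_add,
      weightedSquareSum_add, ENNReal.ofReal_sum_of_nonneg (fun _ _ => by positivity),
      ENNReal.ofReal_sum_of_nonneg (fun _ _ => by positivity)]
    refine add_le_add (add_le_add ?_ ?_) ?_
    · rw [hW₁, weightedSquareSum_familyWeight, ENNReal.ofReal_mul (by norm_num)]
      simp
    · rw [hW₂, weightedSquareSum_familyWeight]
      refine le_trans (le_of_eq ?_) (ENNReal.sum_le_tsum (Finset.range (Nat.log 2 R)))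
      exact Finset.sum_congr rfl fun e _ => ENNReal.ofReal_mul (by positivity)
    · rw [hW₃, weightedSquareSum_familyWeight, ENNReal.tsum_prod (f := fun e t => w (e, t) *
        ENNReal.ofReal ((∑ k ∈ Finset.Ico (t * 2 ^ e) ((t + 1) * 2 ^ e), u k) ^ 2))]
      refine le_trans (Finset.sum_le_sum fun e he => ?_)
        (ENNReal.sum_le_tsum (Finset.range (Nat.log 2 R)))
      refine le_trans ?_ (ENNReal.le_tsum (2 * (R / 2 ^ (e + 1))))
      rw [ENNReal.ofReal_mul (by positivity)]
      refine mul_le_mul_left ?_ _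
      -- The interval removed at level e has t ≥ 2^(log R - e), hence log R ≤ e + log t.
      have hle : 2 ^ (Nat.log 2 R - e) ≤ 2 * (R / 2 ^ (e + 1)) := by
        have he' : e < Nat.log 2 R := Finset.mem_range.1 he
        obtain ⟨d, hd⟩ : ∃ d, Nat.log 2 R = e + 1 + d := ⟨Nat.log 2 R - (e + 1), by omega⟩
        have : 2 ^ d ≤ R / 2 ^ (e + 1) := by
          rw [Nat.le_div_iff_mul_le (by positivity), ← pow_add, add_comm, ← hd]
          exact Nat.pow_log_le_self 2 hR
        rw [hd, show e + 1 + d - e = d + 1 by omega, pow_succ]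
        omega
      have hpos : 2 * (R / 2 ^ (e + 1)) ≠ 0 := by
        have : 0 < 2 ^ (Nat.log 2 R - e) := by positivity
        omega
      simp only [hw, hpos, if_false]
      refine ENNReal.ofReal_le_ofReal ?_
      have := Nat.le_log_of_pow_le one_lt_two hle
      have : Nat.log 2 R ≤ e + Nat.log 2 (2 * (R / 2 ^ (e + 1))) := by omega
      have : (Nat.log 2 R : ℝ) ≤ e + Nat.log 2 (2 * (R / 2 ^ (e + 1))) := by exact_mod_cast this
      linarith
  · set ℓ := Nat.log 2 r
    have hb₁ : weightLoad W₁ r ≤ ENNReal.ofReal 3 := by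
      rw [hW₁, weightLoad_familyWeight, tsum_fintype]
      simp only [Finset.univ_unique, Finset.sum_singleton]
      split_ifs <;> simp
    have hb₂ : weightLoad W₂ r ≤ ENNReal.ofReal (6 * ((ℓ : ℝ) + 1) ^ 2) := by
      rw [hW₂, weightLoad_familyWeight, tsum_eq_single ℓ]
      · split_ifs <;> simp
      · intro e he
        rw [if_neg]
        intro h
        rw [Finset.mem_Ico] at h
        exact he (Nat.log_eq_of_pow_le_of_lt_pow h.1 h.2).symm
    have hb₃ : weightLoad W₃ r ≤ ENNReal.ofReal (3 * (ℓ + 1) * ℓ) := by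
      rw [hW₃, weightLoad_familyWeight, ENNReal.tsum_prod (f := fun e t =>
        if r ∈ Finset.Ico (t * 2 ^ e) ((t + 1) * 2 ^ e) then w (e, t) else 0)]
      have hin : ∀ e, (∑' t, if r ∈ Finset.Ico (t * 2 ^ e) ((t + 1) * 2 ^ e) then w (e, t) else 0)
          = w (e, r / 2 ^ e) := by
        -- At each level e exactly one interval contains r, that with t = r / 2^e.
        intro e
        have key : ∀ t, r ∈ Finset.Ico (t * 2 ^ e) ((t + 1) * 2 ^ e) ↔ t = r / 2 ^ e := by
          intro t
          rw [Finset.mem_Ico, ← Nat.le_div_iff_mul_le (by positivity),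
            ← Nat.div_lt_iff_lt_mul (by positivity)]
          omega
        simp only [key, tsum_ite_eq]
      simp only [hin]
      rw [tsum_eq_sum (s := Finset.range (ℓ + 1))]
      · refine (Finset.sum_le_card_nsmul _ _ (ENNReal.ofReal (3 * ℓ)) fun e _ => ?_).trans ?_
        · simp only [hw]
          split_ifs with h
          · simp
          · refine ENNReal.ofReal_le_ofReal ?_
            have : e + Nat.log 2 (r / 2 ^ e) ≤ ℓ := by
              have hr : r ≠ 0 := by rintro rfl; simp at h
              refine Nat.le_log_of_pow_le one_lt_two ?_
              rw [pow_add]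
              exact (Nat.mul_le_mul_left _ (Nat.pow_log_le_self 2 h)).trans (Nat.mul_div_le r _)
            have : (e : ℝ) + Nat.log 2 (r / 2 ^ e) ≤ ℓ := by exact_mod_cast this
            linarith
        · rw [Finset.card_range, nsmul_eq_mul, ← ENNReal.ofReal_natCast,
            ← ENNReal.ofReal_mul (by positivity)]
          refine ENNReal.ofReal_le_ofReal (le_of_eq ?_)
          push_cast
          ring
      · intro e he
        have : r / 2 ^ e = 0 := by
          rw [Nat.div_eq_zero_iff]
          right
          exact Nat.lt_pow_of_log_lt one_lt_two (by rw [Finset.mem_range] at he; omega)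
        simp [hw, this]
    -- The constant 12 is 3 + 6 + 3, one term for each family.
    rw [weightLoad_add, weightLoad_add]
    refine (add_le_add (add_le_add hb₁ hb₂) hb₃).trans ?_
    rw [← ENNReal.ofReal_add (by positivity) (by positivity),
      ← ENNReal.ofReal_add (by positivity) (by positivity)]
    refine ENNReal.ofReal_le_ofReal ?_
    have : (0 : ℝ) ≤ ℓ := ℓ.cast_nonneg
    nlinarith

/-! ### The majorant of one-dimensional Cesàro means -/

/-- The set of `k` whose number of binary digits belongs to `I`. -/
def binaryBlocks (I : Finset ℕ) : Finset ℕ :=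
  I.biUnion fun r => (Finset.range (2 ^ r)).filter fun k => k.size = r

lemma mem_binaryBlocks {I : Finset ℕ} {k : ℕ} : k ∈ binaryBlocks I ↔ k.size ∈ I := by
  simp only [binaryBlocks, Finset.mem_biUnion, Finset.mem_filter, Finset.mem_range]
  constructor
  · rintro ⟨r, hr, -, rfl⟩
    exact hr
  · exact fun h => ⟨_, h, Nat.lt_size_self k, rfl⟩

lemma sum_binaryBlocks (I : Finset ℕ) (a : ℕ → ℝ) :
    ∑ k ∈ binaryBlocks I, a k = ∑ r ∈ I, ∑ k ∈ binaryBlocks {r}, a k := by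
  have h : binaryBlocks I = I.biUnion fun r => binaryBlocks {r} := by
    ext k
    simp [mem_binaryBlocks]
  rw [h, Finset.sum_biUnion]
  intro r _ r' _ hrr'
  rw [Function.onFun, Finset.disjoint_left]
  intro k hk hk'
  simp only [mem_binaryBlocks, Finset.mem_singleton] at hk hk'
  exact hrr' (hk ▸ hk')

lemma binaryBlocks_range_succ (r : ℕ) :
    binaryBlocks (Finset.range (r + 1)) = Finset.range (2 ^ r) := by
  ext k
  simp [mem_binaryBlocks, Nat.size_le]

/-- Only indices n in the dyadic block of k contribute: there are 2^L of them, each of weight at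
most 2/2^L. -/
lemma tsum_dyadic_remainder_le (k : ℕ) :
    ∑' n : ℕ, (if k ∈ Finset.Ico (2 ^ Nat.log 2 (n + 1)) (n + 1)
      then ENNReal.ofReal (2 / ((n : ℝ) + 1)) else 0) ≤ 2 := by
  set L := Nat.log 2 k
  have hmem : ∀ n, k ∈ Finset.Ico (2 ^ Nat.log 2 (n + 1)) (n + 1) →
      n ∈ Finset.Ico (2 ^ L) (2 ^ (L + 1)) := by
    intro n hn
    rw [Finset.mem_Ico] at hn ⊢
    have hk : k ≠ 0 := by
      have : 0 < 2 ^ Nat.log 2 (n + 1) := by positivity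
      omega
    have hlt := Nat.lt_pow_succ_log_self (b := 2) one_lt_two (n + 1)
    have hL : L = Nat.log 2 (n + 1) := Nat.log_eq_of_pow_le_of_lt_pow hn.1 (by omega)
    have := Nat.pow_log_le_self 2 hk
    rw [← hL] at hlt hn
    omega
  rw [tsum_eq_sum (s := Finset.Ico (2 ^ L) (2 ^ (L + 1)))]
  · refine (Finset.sum_le_card_nsmul _ _ (ENNReal.ofReal (2 / 2 ^ L)) fun n hn => ?_).trans ?_
    · split_ifs
      · refine ENNReal.ofReal_le_ofReal ?_
        have : (2 : ℝ) ^ L ≤ n := by exact_mod_cast (Finset.mem_Ico.1 hn).1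
        gcongr
        linarith
      · simp
    · rw [Nat.card_Ico, nsmul_eq_mul, ← ENNReal.ofReal_natCast,
        ← ENNReal.ofReal_mul (by positivity), ← ENNReal.ofReal_ofNat]
      refine ENNReal.ofReal_le_ofReal (le_of_eq ?_)
      rw [pow_succ, mul_two, Nat.add_sub_cancel]
      push_cast
      field_simp
  · intro n hn
    rw [if_neg (fun h => hn (hmem n h))]

lemma ofReal_add_sq_le (x y : ℝ) :
    ENNReal.ofReal ((x + y) ^ 2) ≤ 2 * ENNReal.ofReal (x ^ 2) + 2 * ENNReal.ofReal (y ^ 2) := by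
  rw [← ENNReal.ofReal_ofNat, ← ENNReal.ofReal_mul (by norm_num),
    ← ENNReal.ofReal_mul (by norm_num), ← ENNReal.ofReal_add (by positivity) (by positivity)]
  exact ENNReal.ofReal_le_ofReal (by nlinarith [sq_nonneg (x - y)])

lemma one_le_logb_logb (k : ℕ) : 1 ≤ Real.logb 2 (Real.logb 2 ((k : ℝ) + 4)) := by
  have h4 : (2 : ℝ) ≤ Real.logb 2 ((k : ℝ) + 4) := by
    rw [Real.le_logb_iff_rpow_le one_lt_two (by positivity)]
    norm_num
  rw [Real.le_logb_iff_rpow_le one_lt_two (by linarith)]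
  simpa using h4

/-- With L = log₂(k+4) ≥ 2, the number of digits is at most L + 1 ≤ 2L, so its logarithm is at most
1 + log L; finally log L ≥ 1 absorbs the constants. -/
lemma log_size_add_one_le (k : ℕ) :
    (Nat.log 2 k.size : ℝ) + 1 ≤ 3 * Real.logb 2 (Real.logb 2 ((k : ℝ) + 4)) := by
  have h1 := one_le_logb_logb k
  rcases Nat.eq_zero_or_pos k.size with h | h
  · rw [h]
    simp
    linarith
  · have h4 : (2 : ℝ) ≤ Real.logb 2 ((k : ℝ) + 4) := by
      rw [Real.le_logb_iff_rpow_le one_lt_two (by positivity)]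
      norm_num
    have hs : ((k.size - 1 : ℕ) : ℝ) ≤ Real.logb 2 ((k : ℝ) + 4) := by
      rw [Real.le_logb_iff_rpow_le one_lt_two (by positivity), Real.rpow_natCast]
      have : 2 ^ (k.size - 1) ≤ k := Nat.lt_size.1 (by omega)
      have : (2 : ℝ) ^ (k.size - 1) ≤ k := by exact_mod_cast this
      linarith
    rw [Nat.cast_sub h] at hs
    push_cast at hs
    have hlog : (Nat.log 2 k.size : ℝ) ≤ Real.logb 2 k.size := by
      rw [Real.le_logb_iff_rpow_le one_lt_two (by exact_mod_cast h), Real.rpow_natCast]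
      exact_mod_cast Nat.pow_log_le_self 2 h.ne'
    have hle : Real.logb 2 k.size ≤ Real.logb 2 (2 * Real.logb 2 ((k : ℝ) + 4)) :=
      Real.logb_le_logb_of_le one_lt_two (by exact_mod_cast h) (by linarith)
    rw [Real.logb_mul (by norm_num) (by linarith), Real.logb_self_eq_one one_lt_two] at hle
    linarith

/-- All quadratic Cesàro means of the partial sums of a series are bounded by one weighted sum of
squares, whose weights have load `O((log log k)²)` at `k`. -/
theorem exists_weight_cesaro_le :
    ∃ W : Finset ℕ → ENNReal,
      (∀ (a : ℕ → ℝ) (N : ℕ),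
        ENNReal.ofReal (1 / (N : ℝ)) *
          ∑ n ∈ Finset.range N, ENNReal.ofReal ((∑ k ∈ Finset.range (n + 1), a k) ^ 2)
            ≤ weightedSquareSum W a) ∧
      ∀ k : ℕ, weightLoad W k
        ≤ ENNReal.ofReal (218 * Real.logb 2 (Real.logb 2 ((k : ℝ) + 4)) ^ 2) := by
  obtain ⟨V, hV, hload⟩ := exists_weight_sq_sum_range_le
  set S : ℕ → Finset ℕ := fun n => Finset.Ico (2 ^ Nat.log 2 (n + 1)) (n + 1) with hS
  -- `W₁` carries the Rademacher–Menshov weights from exponents to dyadic blocks; `W₂` handles the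
  -- remainder between the last power of 2 and n + 1.
  set W₁ := familyWeight V binaryBlocks with hW₁
  set W₂ := familyWeight (fun n : ℕ => ENNReal.ofReal (2 / ((n : ℝ) + 1))) S with hW₂
  refine ⟨(fun I => 2 * W₁ I) + W₂, fun a N => ?_, fun k => ?_⟩
  · rw [weightedSquareSum_add, weightedSquareSum_smul]
    have hblock : ∀ r, ENNReal.ofReal ((∑ k ∈ Finset.range (2 ^ r), a k) ^ 2)
        ≤ weightedSquareSum W₁ a := by
      intro r
      rw [hW₁, weightedSquareSum_familyWeight, ← binaryBlocks_range_succ, sum_binaryBlocks]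
      refine (hV (fun r => ∑ k ∈ binaryBlocks {r}, a k) (r + 1)).trans_eq ?_
      refine tsum_congr fun I => ?_
      rw [sum_binaryBlocks I]
    have hn : ∀ n, ENNReal.ofReal ((∑ k ∈ Finset.range (n + 1), a k) ^ 2)
        ≤ 2 * weightedSquareSum W₁ a + 2 * ENNReal.ofReal ((∑ k ∈ S n, a k) ^ 2) := by
      intro n
      rw [← Finset.sum_range_add_sum_Ico a (Nat.pow_log_le_self 2 n.succ_ne_zero)]
      exact (ofReal_add_sq_le _ _).trans (by gcongr; exact hblock _)
    rw [Finset.mul_sum]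
    calc ∑ n ∈ Finset.range N, ENNReal.ofReal (1 / (N : ℝ)) *
          ENNReal.ofReal ((∑ k ∈ Finset.range (n + 1), a k) ^ 2)
        ≤ ∑ n ∈ Finset.range N, (ENNReal.ofReal (1 / (N : ℝ)) * (2 * weightedSquareSum W₁ a)
            + ENNReal.ofReal (2 / ((n : ℝ) + 1)) * ENNReal.ofReal ((∑ k ∈ S n, a k) ^ 2)) := by
          refine Finset.sum_le_sum fun n hnN => ?_
          refine (mul_le_mul_right (hn n) _).trans ?_
          rw [mul_add]
          refine add_le_add le_rfl ?_
          rw [← mul_assoc]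
          refine mul_le_mul_left ?_ _
          rw [← ENNReal.ofReal_ofNat, ← ENNReal.ofReal_mul (by positivity)]
          refine ENNReal.ofReal_le_ofReal ?_
          -- Passing from 1/N to the larger 1/(n+1) frees the weight of N.
          have : (n : ℝ) + 1 ≤ N := by exact_mod_cast Finset.mem_range.1 hnN
          rw [one_div_mul_eq_div]
          gcongr
      _ ≤ 2 * weightedSquareSum W₁ a + weightedSquareSum W₂ a := by
          rw [Finset.sum_add_distrib]
          refine add_le_add ?_ ?_
          · rw [Finset.sum_const, Finset.card_range, nsmul_eq_mul, ← mul_assoc,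
              ← ENNReal.ofReal_natCast, ← ENNReal.ofReal_mul (by positivity)]
            refine (mul_le_mul_left (ENNReal.ofReal_le_one.2 ?_) _).trans (one_mul _).le
            rw [mul_one_div]
            exact div_self_le_one _
          · rw [hW₂, weightedSquareSum_familyWeight]
            exact ENNReal.sum_le_tsum _
  · have h₁ : weightLoad W₁ k ≤ ENNReal.ofReal (12 * ((Nat.log 2 k.size : ℝ) + 1) ^ 2) := by
      rw [hW₁, weightLoad_familyWeight]
      simp only [mem_binaryBlocks]
      exact hload k.size
    have h₂ : weightLoad W₂ k ≤ 2 := by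
      rw [hW₂, weightLoad_familyWeight]
      exact tsum_dyadic_remainder_le k
    rw [weightLoad_add, weightLoad_smul]
    refine (add_le_add (mul_le_mul_right h₁ 2) h₂).trans ?_
    rw [← ENNReal.ofReal_ofNat, ← ENNReal.ofReal_mul (by norm_num),
      ← ENNReal.ofReal_add (by positivity) (by norm_num)]
    refine ENNReal.ofReal_le_ofReal ?_
    -- The constant is 218 = 2·12·3² + 2, the last 2 being absorbed because the iterated logarithm
    -- is at least 1.
    have h1 := one_le_logb_logb k
    have h2 := log_size_add_one_le k
    have h3 : ((Nat.log 2 k.size : ℝ) + 1) ^ 2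
        ≤ (3 * Real.logb 2 (Real.logb 2 ((k : ℝ) + 4))) ^ 2 := by gcongr
    nlinarith

/-! ### The two-variable majorant and its integral -/

lemma tsum_mul_sum_eq_tsum_weightLoad_mul {κ : Type*} [DecidableEq κ] (W : Finset κ → ENNReal)
    (F : κ → ENNReal) : ∑' I, W I * ∑ k ∈ I, F k = ∑' k, weightLoad W k * F k := by
  have h : ∀ I : Finset κ, W I * ∑ k ∈ I, F k = ∑' k, if k ∈ I then W I * F k else 0 := by
    intro I
    rw [tsum_eq_sum (s := I) (by intro k hk; simp [hk]), Finset.mul_sum]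
    exact Finset.sum_congr rfl fun k hk => by simp [hk]
  simp_rw [h]
  rw [ENNReal.tsum_comm]
  refine tsum_congr fun k => ?_
  rw [weightLoad, ← ENNReal.tsum_mul_right]
  exact tsum_congr fun I => by split_ifs <;> simp

/-- The tensor square of `weightedSquareSum W`, applied to a double sequence. -/
noncomputable def doubleSquareSum {κ : Type*} (W : Finset κ → ENNReal) (b : κ × κ → ℝ) : ENNReal :=
  ∑' I, W I * ∑' J, W J * ENNReal.ofReal ((∑ p ∈ I ×ˢ J, b p) ^ 2)

/-- For fixed n the inequality is applied in j to the sums over k; then, for each I, it is applied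
in k to the sums over j ∈ I. -/
lemma double_cesaro_le {W : Finset ℕ → ENNReal}
    (hW : ∀ (a : ℕ → ℝ) (N : ℕ), ENNReal.ofReal (1 / (N : ℝ)) *
      ∑ n ∈ Finset.range N, ENNReal.ofReal ((∑ k ∈ Finset.range (n + 1), a k) ^ 2)
        ≤ weightedSquareSum W a) (b : ℕ × ℕ → ℝ) (M N : ℕ) :
    ENNReal.ofReal (1 / (N : ℝ)) * ∑ n ∈ Finset.range N, ENNReal.ofReal (1 / (M : ℝ)) *
      ∑ m ∈ Finset.range M, ENNReal.ofReal
        ((∑ p ∈ Finset.range (m + 1) ×ˢ Finset.range (n + 1), b p) ^ 2)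
      ≤ doubleSquareSum W b := by
  calc _ ≤ ENNReal.ofReal (1 / (N : ℝ)) * ∑ n ∈ Finset.range N, ∑' I, W I *
        ENNReal.ofReal ((∑ k ∈ Finset.range (n + 1), ∑ j ∈ I, b (j, k)) ^ 2) := by
        refine mul_le_mul_right (Finset.sum_le_sum fun n _ => ?_) _
        have := hW (fun j => ∑ k ∈ Finset.range (n + 1), b (j, k)) M
        simp only [weightedSquareSum] at this
        simp only [Finset.sum_product]
        refine this.trans_eq (tsum_congr fun I => ?_)
        rw [Finset.sum_comm]
    _ = ∑' I, W I * (ENNReal.ofReal (1 / (N : ℝ)) * ∑ n ∈ Finset.range N,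
        ENNReal.ofReal ((∑ k ∈ Finset.range (n + 1), ∑ j ∈ I, b (j, k)) ^ 2)) := by
        rw [← Summable.tsum_finsetSum (fun _ _ => ENNReal.summable), ← ENNReal.tsum_mul_left]
        refine tsum_congr fun I => ?_
        rw [← Finset.mul_sum, mul_left_comm]
    _ ≤ doubleSquareSum W b := by
        refine ENNReal.tsum_le_tsum fun I => mul_le_mul_right ?_ _
        refine (hW (fun k => ∑ j ∈ I, b (j, k)) N).trans_eq (tsum_congr fun J => ?_)
        rw [Finset.sum_product_right]

lemma lintegral_sq_sum_of_orthogonal {X κ : Type*} [MeasurableSpace X] {μ : Measure X}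
    {f : κ → X → ℝ} (hf : ∀ p, MemLp (f p) 2 μ)
    (horth : ∀ p q, p ≠ q → ∫ x, f p x * f q x ∂μ = 0) (s : Finset κ) :
    ∫⁻ x, ENNReal.ofReal ((∑ p ∈ s, f p x) ^ 2) ∂μ
      = ∑ p ∈ s, ENNReal.ofReal (∫ x, f p x ^ 2 ∂μ) := by
  classical
  have hint : ∀ p q, Integrable (fun x => f p x * f q x) μ := fun p q => (hf p).integrable_mul (hf q)
  have hsq : ∀ x, (∑ p ∈ s, f p x) ^ 2 = ∑ p ∈ s, ∑ q ∈ s, f p x * f q x := by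
    intro x
    rw [sq, Finset.sum_mul_sum]
  rw [← ofReal_integral_eq_lintegral_ofReal]
  · rw [← ENNReal.ofReal_sum_of_nonneg (fun p _ => integral_nonneg fun x => sq_nonneg _)]
    simp_rw [hsq]
    rw [integral_finsetSum _ fun p _ => integrable_finsetSum _ fun q _ => hint p q]
    congr 1
    refine Finset.sum_congr rfl fun p hp => ?_
    rw [integral_finsetSum _ fun q _ => hint p q, Finset.sum_eq_single p]
    · simp_rw [sq]
    · exact fun q _ hq => horth p q hq.symm
    · exact fun h => absurd hp h
  · simp_rw [hsq]
    exact integrable_finsetSum _ fun p _ => integrable_finsetSum _ fun q _ => hint p q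
  · exact Eventually.of_forall fun x => sq_nonneg _

lemma aemeasurable_sq_sum {X κ : Type*} [MeasurableSpace X] {μ : Measure X}
    {f : κ → X → ℝ} (hf : ∀ p, MemLp (f p) 2 μ) (s : Finset κ) :
    AEMeasurable (fun x => ENNReal.ofReal ((∑ p ∈ s, f p x) ^ 2)) μ :=
  ((Finset.aemeasurable_fun_sum s fun p _ =>
    (hf p).aestronglyMeasurable.aemeasurable).pow_const 2).ennreal_ofReal

lemma aemeasurable_doubleSquareSum {X κ : Type*} [Countable κ] [MeasurableSpace X] {μ : Measure X}
    (W : Finset κ → ENNReal) {f : κ × κ → X → ℝ} (hf : ∀ p, MemLp (f p) 2 μ) :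
    AEMeasurable (fun x => doubleSquareSum W fun p => f p x) μ :=
  AEMeasurable.tsum fun _ => (AEMeasurable.tsum fun _ =>
    (aemeasurable_sq_sum hf _).const_mul _).const_mul _

/-- Orthogonality turns each squared rectangle sum into a sum of squared norms; collecting the
weights at each index gives a product of two loads. -/
lemma lintegral_doubleSquareSum {X κ : Type*} [Countable κ] [DecidableEq κ] [MeasurableSpace X]
    {μ : Measure X} (W : Finset κ → ENNReal) {f : κ × κ → X → ℝ} (hf : ∀ p, MemLp (f p) 2 μ)
    (horth : ∀ p q, p ≠ q → ∫ x, f p x * f q x ∂μ = 0) :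
    ∫⁻ x, doubleSquareSum W (fun p => f p x) ∂μ
      = ∑' p : κ × κ, weightLoad W p.1 * (weightLoad W p.2 *
          ENNReal.ofReal (∫ x, f p x ^ 2 ∂μ)) := by
  unfold doubleSquareSum
  have hm : ∀ I J : Finset κ, AEMeasurable
      (fun x => W J * ENNReal.ofReal ((∑ p ∈ I ×ˢ J, f p x) ^ 2)) μ :=
    fun I J => (aemeasurable_sq_sum hf _).const_mul _
  rw [lintegral_tsum fun I => (AEMeasurable.tsum (hm I)).const_mul _]
  have hI : ∀ I : Finset κ, ∫⁻ x, W I * ∑' J, W J *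
      ENNReal.ofReal ((∑ p ∈ I ×ˢ J, f p x) ^ 2) ∂μ
      = W I * ∑ j ∈ I, ∑' k, weightLoad W k * ENNReal.ofReal (∫ x, f (j, k) x ^ 2 ∂μ) := by
    intro I
    rw [lintegral_const_mul'' _ (AEMeasurable.tsum (hm I)), lintegral_tsum (hm I)]
    congr 1
    rw [← Summable.tsum_finsetSum (fun _ _ => ENNReal.summable)]
    simp_rw [← Finset.mul_sum]
    rw [← tsum_mul_sum_eq_tsum_weightLoad_mul]
    refine tsum_congr fun J => ?_
    rw [lintegral_const_mul'' _ (aemeasurable_sq_sum hf _),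
      lintegral_sq_sum_of_orthogonal hf horth, Finset.sum_product_right]
  simp_rw [hI]
  rw [tsum_mul_sum_eq_tsum_weightLoad_mul, ENNReal.tsum_prod (f := fun j k => weightLoad W j *
    (weightLoad W k * ENNReal.ofReal (∫ x, f (j, k) x ^ 2 ∂μ)))]
  simp_rw [ENNReal.tsum_mul_left]

/-! ### Rectangular sums and the pointwise convergence argument -/

lemma sum_Icc_one_pnat (F : ℕ+ → ℝ) (m : ℕ+) :
    ∑ j ∈ Finset.Icc 1 m, F j = ∑ i ∈ Finset.range m, F i.succPNat := by
  symm
  refine Finset.sum_bij (fun i _ => i.succPNat) (fun i hi => ?_) (fun i _ j _ h => ?_)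
    (fun j hj => ?_) (fun _ _ => rfl)
  · rw [Finset.mem_Icc]
    refine ⟨one_le, ?_⟩
    rw [← PNat.coe_le_coe, Nat.succPNat_coe]
    exact Finset.mem_range.1 hi
  · exact Nat.succPNat_injective h
  · refine ⟨j.natPred, ?_, PNat.succPNat_natPred j⟩
    rw [Finset.mem_range]
    have h1 := (Finset.mem_Icc.1 hj).2
    rw [← PNat.coe_le_coe] at h1
    have := PNat.natPred_add_one j
    omega

lemma rectPartialSum_eq {X : Type*} (c : ℕ+ → ℕ+ → ℝ) (ψ : ℕ+ → ℕ+ → X → ℝ) (m n : ℕ+) (x : X) :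
    rectPartialSum c ψ m n x = ∑ p ∈ Finset.range m ×ˢ Finset.range n,
      c p.1.succPNat p.2.succPNat * ψ p.1.succPNat p.2.succPNat x := by
  rw [rectPartialSum, sum_Icc_one_pnat, Finset.sum_product]
  exact Finset.sum_congr rfl fun j _ => sum_Icc_one_pnat _ n

/-- Links unconditional convergence over finite sets to convergence in Pringsheim's sense. -/
lemma tendsto_range_product_range :
    Tendsto (fun p : ℕ × ℕ => Finset.range p.1 ×ˢ Finset.range p.2) atTop atTop := by
  rw [tendsto_atTop]
  intro s
  obtain ⟨K, hK⟩ : ∃ K, ∀ q ∈ s, q.1 < K ∧ q.2 < K := by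
    refine ⟨s.sup (fun q => max q.1 q.2) + 1, fun q hq => ?_⟩
    have := Finset.le_sup (f := fun q : ℕ × ℕ => max q.1 q.2) hq
    have h1 := le_max_left q.1 q.2
    have h2 := le_max_right q.1 q.2
    omega
  filter_upwards [eventually_ge_atTop (K, K)] with p hp q hq
  have h1 : K ≤ p.1 := hp.1
  have h2 : K ≤ p.2 := hp.2
  have := hK q hq
  rw [Finset.mem_product, Finset.mem_range, Finset.mem_range]
  omega

/-- With P the rectangle and Q the K×K square, ∑_P b - g = ∑_{P∖Q} b - ∑_{Q∖P} b + (∑_Q b - g), and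
Q∖P is empty unless m < K or n < K. -/
lemma sq_sum_sub_le {b : ℕ × ℕ → ℝ} (g : ℝ) (K m n : ℕ) :
    (∑ p ∈ Finset.range (m + 1) ×ˢ Finset.range (n + 1), b p - g) ^ 2
      ≤ 3 * (∑ p ∈ Finset.range (m + 1) ×ˢ Finset.range (n + 1),
          if p ∈ Finset.range K ×ˢ Finset.range K then 0 else b p) ^ 2
        + 3 * (∑ p ∈ Finset.range K ×ˢ Finset.range K, |b p|) ^ 2
          * ((if m < K then 1 else 0) + (if n < K then 1 else 0))
        + 3 * (∑ p ∈ Finset.range K ×ˢ Finset.range K, b p - g) ^ 2 := by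
  set P := Finset.range (m + 1) ×ˢ Finset.range (n + 1)
  set Q := Finset.range K ×ˢ Finset.range K with hQ
  set T := ∑ p ∈ P, if p ∈ Q then 0 else b p with hT
  have hTP : T = ∑ p ∈ P \ Q, b p := by
    rw [hT, Finset.sdiff_eq_filter, Finset.sum_filter]
    exact Finset.sum_congr rfl fun p _ => by by_cases h : p ∈ Q <;> simp [h]
  have h1 := Finset.sum_inter_add_sum_sdiff P Q b
  have h2 := Finset.sum_inter_add_sum_sdiff Q P b
  rw [Finset.inter_comm] at h2
  have heq : ∑ p ∈ P, b p - g = T - ∑ p ∈ Q \ P, b p + (∑ p ∈ Q, b p - g) := by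
    rw [hTP]
    linarith
  have hR : (∑ p ∈ Q \ P, b p) ^ 2 ≤ (∑ p ∈ Q, |b p|) ^ 2
      * ((if m < K then 1 else 0) + (if n < K then 1 else 0)) := by
    by_cases h : m < K ∨ n < K
    · have hA : (∑ p ∈ Q \ P, b p) ^ 2 ≤ (∑ p ∈ Q, |b p|) ^ 2 := by
        rw [← sq_abs]
        gcongr
        exact (Finset.abs_sum_le_sum_abs _ _).trans
          (Finset.sum_le_sum_of_subset_of_nonneg Finset.sdiff_subset fun _ _ _ => abs_nonneg _)
      refine hA.trans (le_mul_of_one_le_right (sq_nonneg _) ?_)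
      rcases h with h | h <;> simp only [h, if_true] <;> split_ifs <;> norm_num
    · have hsub : Q \ P = ∅ := by
        rw [Finset.sdiff_eq_empty_iff_subset]
        intro p hp
        rw [hQ, Finset.mem_product, Finset.mem_range, Finset.mem_range] at hp
        rw [Finset.mem_product, Finset.mem_range, Finset.mem_range]
        omega
      rw [hsub, Finset.sum_empty, zero_pow two_ne_zero]
      positivity
  rw [heq]
  set y := ∑ p ∈ Q \ P, b p
  set z := ∑ p ∈ Q, b p - g
  nlinarith [sq_nonneg (T + y), sq_nonneg (T - z), sq_nonneg (y + z)]

lemma sum_range_ite_lt_le (K M : ℕ) :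
    ∑ m ∈ Finset.range M, (if m < K then (1 : ℝ) else 0) ≤ K := by
  rw [← Finset.sum_filter, Finset.sum_const, nsmul_eq_mul, mul_one]
  have : ((Finset.range M).filter fun m => m < K).card ≤ (Finset.range K).card :=
    Finset.card_le_card fun m hm => by simpa using (Finset.mem_filter.1 hm).2
  rw [Finset.card_range] at this
  exact_mod_cast this

lemma sum_sum_sq_le_of_doubleSquareSum_le {W : Finset ℕ → ENNReal}
    (hW : ∀ (a : ℕ → ℝ) (N : ℕ), ENNReal.ofReal (1 / (N : ℝ)) *
      ∑ n ∈ Finset.range N, ENNReal.ofReal ((∑ k ∈ Finset.range (n + 1), a k) ^ 2)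
        ≤ weightedSquareSum W a) {b : ℕ × ℕ → ℝ} {ε : ℝ} (hε : 0 ≤ ε)
    (hb : doubleSquareSum W b ≤ ENNReal.ofReal ε) {M N : ℕ} (hM : (0 : ℝ) < M) (hN : (0 : ℝ) < N) :
    ∑ m ∈ Finset.range M, ∑ n ∈ Finset.range N,
      (∑ p ∈ Finset.range (m + 1) ×ˢ Finset.range (n + 1), b p) ^ 2 ≤ ε * (M * N) := by
  have h := (double_cesaro_le hW b M N).trans hb
  have h' : 1 / (N : ℝ) * ∑ n ∈ Finset.range N, 1 / (M : ℝ) * ∑ m ∈ Finset.range M,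
      (∑ p ∈ Finset.range (m + 1) ×ˢ Finset.range (n + 1), b p) ^ 2 ≤ ε := by
    rw [← ENNReal.ofReal_le_ofReal_iff hε]
    refine le_trans (le_of_eq ?_) h
    rw [ENNReal.ofReal_mul (by positivity), ENNReal.ofReal_sum_of_nonneg fun _ _ => by positivity]
    congr 1
    refine Finset.sum_congr rfl fun n _ => ?_
    rw [ENNReal.ofReal_mul (by positivity), ENNReal.ofReal_sum_of_nonneg fun _ _ => by positivity]
  rw [← Finset.mul_sum, Finset.sum_comm, ← mul_assoc, div_mul_div_comm, one_mul,
    one_div_mul_eq_div, div_le_iff₀ (by positivity)] at h'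
  linarith

/-- If the tails of a double series have small Cesàro majorants and its square partial sums come
close to `g`, then the double series is strongly Cesàro summable to `g`. -/
lemma eventually_cesaro_le {W : Finset ℕ → ENNReal}
    (hW : ∀ (a : ℕ → ℝ) (N : ℕ), ENNReal.ofReal (1 / (N : ℝ)) *
      ∑ n ∈ Finset.range N, ENNReal.ofReal ((∑ k ∈ Finset.range (n + 1), a k) ^ 2)
        ≤ weightedSquareSum W a) {b : ℕ × ℕ → ℝ} {g ε : ℝ} {K : ℕ} (hε : 0 < ε)
    (hK : doubleSquareSum W (fun p => if p ∈ Finset.range K ×ˢ Finset.range K then 0 else b p)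
      + ENNReal.ofReal ((∑ p ∈ Finset.range K ×ˢ Finset.range K, b p - g) ^ 2)
        ≤ ENNReal.ofReal ε) :
    ∃ M₀ : ℕ, ∀ M N : ℕ, M₀ ≤ M → M₀ ≤ N →
      1 / ((M : ℝ) * N) * ∑ m ∈ Finset.range M, ∑ n ∈ Finset.range N,
        (∑ p ∈ Finset.range (m + 1) ×ˢ Finset.range (n + 1), b p - g) ^ 2 ≤ 7 * ε := by
  set A := (∑ p ∈ Finset.range K ×ˢ Finset.range K, |b p|) ^ 2 with hA
  set h := (∑ p ∈ Finset.range K ×ˢ Finset.range K, b p - g) ^ 2 with hh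
  set T : ℕ → ℕ → ℝ := fun m n => ∑ p ∈ Finset.range (m + 1) ×ˢ Finset.range (n + 1),
    if p ∈ Finset.range K ×ˢ Finset.range K then 0 else b p with hT
  have hhε : h ≤ ε := by
    rw [← ENNReal.ofReal_le_ofReal_iff hε.le]
    exact le_trans le_add_self hK
  -- This threshold brings the terms with m < K or n < K, at most 3A(NK + MK), below εMN. The tail
  -- and the distance to g give 3ε each, hence 7ε.
  obtain ⟨M₀, hM₀⟩ := exists_nat_gt (6 * A * K / ε)
  refine ⟨M₀ + 1, fun M N hM hN => ?_⟩
  have hM' : (M₀ : ℝ) + 1 ≤ M := by exact_mod_cast hM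
  have hN' : (M₀ : ℝ) + 1 ≤ N := by exact_mod_cast hN
  have hM0 : (0 : ℝ) ≤ M₀ := M₀.cast_nonneg
  have hMpos : (0 : ℝ) < M := by linarith
  have hNpos : (0 : ℝ) < N := by linarith
  have hAM : 6 * A * K ≤ ε * M := by
    rw [div_lt_iff₀ hε] at hM₀
    nlinarith
  have hAN : 6 * A * K ≤ ε * N := by
    rw [div_lt_iff₀ hε] at hM₀
    nlinarith
  have hTMN : ∑ m ∈ Finset.range M, ∑ n ∈ Finset.range N, T m n ^ 2 ≤ ε * (M * N) := by
    exact sum_sum_sq_le_of_doubleSquareSum_le hW hε.le (le_trans le_self_add hK) hMpos hNpos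
  have hcount : ∑ m ∈ Finset.range M, ∑ n ∈ Finset.range N,
      ((if m < K then (1 : ℝ) else 0) + (if n < K then 1 else 0)) ≤ N * K + M * K := by
    simp only [Finset.sum_add_distrib, Finset.sum_const, Finset.card_range, nsmul_eq_mul,
      ← Finset.mul_sum]
    gcongr <;> exact sum_range_ite_lt_le _ _
  have hsum : ∑ m ∈ Finset.range M, ∑ n ∈ Finset.range N,
        (∑ p ∈ Finset.range (m + 1) ×ˢ Finset.range (n + 1), b p - g) ^ 2
      ≤ 3 * ∑ m ∈ Finset.range M, ∑ n ∈ Finset.range N, T m n ^ 2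
        + 3 * A * ∑ m ∈ Finset.range M, ∑ n ∈ Finset.range N,
          ((if m < K then (1 : ℝ) else 0) + (if n < K then 1 else 0)) + M * N * (3 * h) := by
    refine (Finset.sum_le_sum fun m _ => Finset.sum_le_sum fun n _ =>
      sq_sum_sub_le g K m n).trans (le_of_eq ?_)
    simp only [Finset.sum_add_distrib, Finset.mul_sum, Finset.sum_const, Finset.card_range,
      nsmul_eq_mul, mul_add, ← hA, ← hh, hT]
    ring_nf
  have hA0 : 0 ≤ A := sq_nonneg _
  rw [one_div_mul_eq_div, div_le_iff₀ (by positivity)]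
  have h3 := mul_le_mul_of_nonneg_left hcount (by positivity : 0 ≤ 3 * A)
  have h4 := mul_le_mul_of_nonneg_left hhε (by positivity : 0 ≤ 3 * ((M : ℝ) * N))
  have h5 := mul_le_mul_of_nonneg_left hAM hNpos.le
  have h6 := mul_le_mul_of_nonneg_left hAN hMpos.le
  linarith

/-! ### Convergence in L² -/

lemma integral_sq_eq_norm_sq {X : Type*} [MeasurableSpace X] {μ : Measure X} (F : Lp ℝ 2 μ)
    {f : X → ℝ} (h : F =ᵐ[μ] f) : ∫ x, f x ^ 2 ∂μ = ‖F‖ ^ 2 := by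
  rw [← real_inner_self_eq_norm_sq, L2.inner_def]
  refine integral_congr_ae ?_
  filter_upwards [h] with x hx
  rw [hx, real_inner_self_eq_norm_sq, Real.norm_eq_abs, sq_abs]

lemma inner_toLp_eq_integral_mul {X : Type*} [MeasurableSpace X] {μ : Measure X} {f g : X → ℝ}
    (hf : MemLp f 2 μ) (hg : MemLp g 2 μ) :
    inner ℝ (hf.toLp f) (hg.toLp g) = ∫ x, f x * g x ∂μ := by
  rw [L2.inner_def]
  refine integral_congr_ae ?_
  filter_upwards [hf.coeFn_toLp, hg.coeFn_toLp] with x h1 h2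
  rw [h1, h2, real_inner_eq_re_inner, RCLike.inner_apply]
  simp [mul_comm]

lemma coeFn_sum_smul_toLp {X κ : Type*} [MeasurableSpace X] {μ : Measure X} {ψ : κ → X → ℝ}
    (hψ : ∀ p, MemLp (ψ p) 2 μ) (c : κ → ℝ) (s : Finset κ) :
    ((∑ p ∈ s, c p • (hψ p).toLp (ψ p) : Lp ℝ 2 μ) : X → ℝ)
      =ᵐ[μ] fun x => ∑ p ∈ s, c p * ψ p x := by
  classical
  induction s using Finset.induction_on with
  | empty =>
    simp only [Finset.sum_empty]
    exact Lp.coeFn_zero _ _ _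
  | insert p s hp ih =>
    rw [Finset.sum_insert hp]
    filter_upwards [Lp.coeFn_add (c p • (hψ p).toLp (ψ p)) (∑ p ∈ s, c p • (hψ p).toLp (ψ p)), ih,
      Lp.coeFn_smul (c p) ((hψ p).toLp (ψ p)), (hψ p).coeFn_toLp] with x h1 h2 h3 h4
    rw [h1, Pi.add_apply, h2, h3, Pi.smul_apply, h4, Finset.sum_insert hp, smul_eq_mul]

/-- The Riesz–Fischer theorem for an orthonormal system indexed by an arbitrary type. -/
theorem exists_tendsto_integral_sq_sum_sub {X κ : Type*} [MeasurableSpace X] {μ : Measure X}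
    {ψ : κ → X → ℝ} (hψ : ∀ p, MemLp (ψ p) 2 μ) (hnorm : ∀ p, ∫ x, ψ p x ^ 2 ∂μ = 1)
    (horth : ∀ p q, p ≠ q → ∫ x, ψ p x * ψ q x ∂μ = 0) {c : κ → ℝ}
    (hc : Summable fun p => c p ^ 2) :
    ∃ g : X → ℝ, MemLp g 2 μ ∧
      Tendsto (fun s : Finset κ => ∫ x, (∑ p ∈ s, c p * ψ p x - g x) ^ 2 ∂μ) atTop (𝓝 0) := by
  classical
  set e : κ → Lp ℝ 2 μ := fun p => (hψ p).toLp (ψ p) with he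
  have hon : Orthonormal ℝ e := by
    rw [orthonormal_iff_ite]
    intro p q
    rw [he, inner_toLp_eq_integral_mul]
    split_ifs with h
    · subst h
      simpa only [sq] using hnorm p
    · exact horth p q h
  have hsum : Summable fun p => c p • e p := by
    refine (hon.orthogonalFamily.summable_iff_norm_sq_summable c).2 ?_
    simpa using hc
  refine ⟨(∑' p, c p • e p : Lp ℝ 2 μ), Lp.memLp _, ?_⟩
  have h := ((tendsto_iff_norm_sub_tendsto_zero.1 hsum.hasSum).pow 2)
  rw [zero_pow two_ne_zero] at h
  refine h.congr fun s => (integral_sq_eq_norm_sq _ ?_).symm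
  filter_upwards [Lp.coeFn_sub (∑ p ∈ s, c p • e p) (∑' p, c p • e p),
    coeFn_sum_smul_toLp hψ c s] with x h1 h2
  change (∑ p ∈ s, c p • e p - ∑' p, c p • e p : Lp ℝ 2 μ) x = _
  rw [h1, Pi.sub_apply, h2]

/-! ### Convergence in mean of the majorants, and the conclusion -/

lemma logLog_succPNat (k : ℕ) :
    logLog k.succPNat = Real.logb 2 (Real.logb 2 ((k : ℝ) + 4)) := by
  rw [logLog, Nat.succPNat_coe, Nat.succ_eq_add_one]
  push_cast
  rw [add_assoc]
  norm_num

lemma isL2Sum_tendsto_diag {X : Type*} [MeasurableSpace X] {μ : Measure X}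
    {ψ : ℕ+ → ℕ+ → X → ℝ} (hψ : ∀ j k, MemLp (ψ j k) 2 μ) {c : ℕ+ → ℕ+ → ℝ} {g : X → ℝ}
    (hg : IsL2Sum μ c ψ g) :
    Tendsto (fun K : ℕ => ∫⁻ x, ENNReal.ofReal
      ((∑ p ∈ Finset.range (K + 1) ×ˢ Finset.range (K + 1),
        c p.1.succPNat p.2.succPNat * ψ p.1.succPNat p.2.succPNat x - g x) ^ 2) ∂μ)
      atTop (𝓝 0) := by
  have hdiag : Tendsto (fun K : ℕ => (K.succPNat, K.succPNat)) atTop atTop := by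
    have h : Tendsto Nat.succPNat atTop atTop :=
      tendsto_atTop_mono' _ (Eventually.of_forall fun _ => le_rfl)
        (OrderIso.pnatIsoNat.symm.tendsto_atTop)
    rw [← prod_atTop_atTop_eq]
    exact h.prodMk h
  have h := ENNReal.tendsto_ofReal (hg.2.comp hdiag)
  rw [ENNReal.ofReal_zero] at h
  refine h.congr fun K => ?_
  simp only [Function.comp_apply, rectPartialSum_eq, sq_abs, Nat.succPNat_coe,
    Nat.succ_eq_add_one]
  refine ofReal_integral_eq_lintegral_ofReal ?_ (Eventually.of_forall fun x => sq_nonneg _)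
  exact ((memLp_finsetSum _ fun p _ => (hψ _ _).const_mul _).sub hg.1).integrable_sq

/-- Fatou's lemma forces the lower limit to vanish almost everywhere. One good K for each x and ε
suffices later, so convergence along the whole sequence is not needed. -/
lemma ae_frequently_lt_of_tendsto_lintegral_zero {X : Type*} [MeasurableSpace X] {μ : Measure X}
    {H : ℕ → X → ENNReal} (hH : ∀ K, AEMeasurable (H K) μ)
    (h : Tendsto (fun K => ∫⁻ x, H K x ∂μ) atTop (𝓝 0)) :
    ∀ᵐ x ∂μ, ∀ ε > 0, ∃ K, H K x < ε := by
  have h0 : ∫⁻ x, liminf (fun K => H K x) atTop ∂μ = 0 :=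
    le_antisymm ((lintegral_liminf_le' hH).trans_eq h.liminf_eq) zero_le
  have hmeas : AEMeasurable (fun x => liminf (fun K => H K x) atTop) μ := by
    refine ⟨fun x => liminf (fun K => (hH K).mk (H K) x) atTop,
      Measurable.liminf fun K => (hH K).measurable_mk, ?_⟩
    filter_upwards [ae_all_iff.2 fun K => (hH K).ae_eq_mk] with x hx
    simp only [hx]
  rw [lintegral_eq_zero_iff' hmeas] at h0
  filter_upwards [h0] with x hx ε hε
  exact (frequently_lt_of_liminf_lt (by isBoundedDefault) (by rw [hx]; exact hε)).exists

/-- The Cesàro majorants of the tails of the double series tend to zero in mean. -/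
lemma tendsto_lintegral_doubleSquareSum_tail {X : Type*} [MeasurableSpace X] {μ : Measure X}
    {φ : ℕ × ℕ → X → ℝ} (hφ : ∀ p, MemLp (φ p) 2 μ) (hnorm : ∀ p, ∫ x, φ p x ^ 2 ∂μ = 1)
    (horth : ∀ p q, p ≠ q → ∫ x, φ p x * φ q x ∂μ = 0) {c : ℕ × ℕ → ℝ} {ℓ : ℕ → ℝ} {A : ℝ}
    {W : Finset ℕ → ENNReal} (hW : ∀ k, weightLoad W k ≤ ENNReal.ofReal (A * ℓ k ^ 2))
    (hA : 0 ≤ A) (hc : Summable fun p : ℕ × ℕ => c p ^ 2 * ℓ p.1 ^ 2 * ℓ p.2 ^ 2) :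
    Tendsto (fun s : Finset (ℕ × ℕ) =>
      ∫⁻ x, doubleSquareSum W (fun p => if p ∈ s then 0 else c p * φ p x) ∂μ) atTop (𝓝 0) := by
  set E : ℕ × ℕ → ENNReal := fun p => ENNReal.ofReal (A ^ 2 * (c p ^ 2 * ℓ p.1 ^ 2 * ℓ p.2 ^ 2))
    with hE
  have hEtop : ∑' p, E p ≠ ⊤ := (hc.mul_left (A ^ 2)).tsum_ofReal_ne_top
  -- After integration the majorant is at most the part outside s of the convergent series ∑ A² c²
  -- ℓ² ℓ².
  refine tendsto_of_tendsto_of_tendsto_of_le_of_le tendsto_const_nhds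
    (ENNReal.tendsto_tsum_compl_atTop_zero hEtop) (fun _ => zero_le) fun s => ?_
  have hmem : ∀ p, MemLp (fun x => if p ∈ s then 0 else c p * φ p x) 2 μ := by
    intro p
    by_cases hp : p ∈ s
    · simp [hp]
    · simpa [hp] using (hφ p).const_mul (c p)
  have horth' : ∀ p q, p ≠ q → ∫ x, (if p ∈ s then 0 else c p * φ p x) *
      (if q ∈ s then 0 else c q * φ q x) ∂μ = 0 := by
    intro p q hpq
    by_cases hp : p ∈ s
    · simp [hp]
    · by_cases hq : q ∈ s
      · simp [hq]
      · simp only [hp, hq, if_false]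
        have hx : ∀ x, c p * φ p x * (c q * φ q x) = c p * c q * (φ p x * φ q x) :=
          fun x => mul_mul_mul_comm _ _ _ _
        rw [integral_congr_ae (Eventually.of_forall hx), integral_const_mul, horth p q hpq, mul_zero]
  change ∫⁻ x, doubleSquareSum W (fun p => if p ∈ s then 0 else c p * φ p x) ∂μ ≤ _
  rw [lintegral_doubleSquareSum W hmem horth']
  have hsub : ∑' p : {p // p ∉ s}, E p = ∑' p, Set.indicator {p | p ∉ s} E p :=
    tsum_subtype {p | p ∉ s} E
  rw [hsub]
  refine ENNReal.tsum_le_tsum fun p => ?_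
  by_cases hp : p ∈ s
  · simp [hp]
  · simp only [hp, if_false, Set.indicator, Set.mem_ofPred_eq, not_false_eq_true, if_true,
      mul_pow, integral_const_mul, hnorm, mul_one]
    refine (mul_le_mul' (hW _) (mul_le_mul' (hW _) le_rfl)).trans (le_of_eq ?_)
    rw [← ENNReal.ofReal_mul (by positivity), ← ENNReal.ofReal_mul (by positivity), hE]
    congr 1
    ring

theorem theorem2 {X : Type*} [MeasurableSpace X] (μ : Measure X) [IsFiniteMeasure μ]
    (ψ : ℕ+ → ℕ+ → X → ℝ) (hψ : IsDoubleONS μ ψ) (c : ℕ+ → ℕ+ → ℝ)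
    (hc : Summable (fun p : ℕ+ × ℕ+ => c p.1 p.2 ^ 2 * logLog p.1 ^ 2 * logLog p.2 ^ 2)) :
    (∃ g : X → ℝ, IsL2Sum μ c ψ g) ∧
      ∀ g : X → ℝ, IsL2Sum μ c ψ g →
        ∀ᵐ x ∂μ, StronglyCesaroSummable (fun m n => rectPartialSum c ψ m n x) (g x) := by
  set φ : ℕ × ℕ → X → ℝ := fun p => ψ p.1.succPNat p.2.succPNat with hφdef
  set C : ℕ × ℕ → ℝ := fun p => c p.1.succPNat p.2.succPNat with hCdef
  set ℓ : ℕ → ℝ := fun k => Real.logb 2 (Real.logb 2 ((k : ℝ) + 4)) with hℓ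
  have hφ : ∀ p, MemLp (φ p) 2 μ := fun p => hψ.memLp _ _
  have hnorm : ∀ p, ∫ x, φ p x ^ 2 ∂μ = 1 := fun p => hψ.integral_sq _ _
  have horth : ∀ p q, p ≠ q → ∫ x, φ p x * φ q x ∂μ = 0 := by
    intro p q hpq
    refine hψ.integral_mul _ _ _ _ fun h => hpq ?_
    rw [Prod.mk.injEq] at h
    exact Prod.ext (Nat.succPNat_injective h.1) (Nat.succPNat_injective h.2)
  have hC : Summable fun p : ℕ × ℕ => C p ^ 2 * ℓ p.1 ^ 2 * ℓ p.2 ^ 2 := by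
    have := hc.comp_injective (Nat.succPNat_injective.prodMap Nat.succPNat_injective)
    simpa only [Function.comp_def, Prod.map, logLog_succPNat] using this
  refine ⟨?_, fun g hg => ?_⟩
  · have hC2 : Summable fun p => C p ^ 2 := by
      refine Summable.of_nonneg_of_le (fun _ => sq_nonneg _) (fun p => ?_) hC
      have h1 : 1 ≤ ℓ p.1 ^ 2 := one_le_pow₀ (one_le_logb_logb _)
      have h2 : 1 ≤ ℓ p.2 ^ 2 := one_le_pow₀ (one_le_logb_logb _)
      rw [mul_assoc]
      exact le_mul_of_one_le_right (sq_nonneg _) (one_le_mul_of_one_le_of_one_le h1 h2)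
    obtain ⟨g, hg, hlim⟩ := exists_tendsto_integral_sq_sum_sub hφ hnorm horth hC2
    refine ⟨g, hg, ?_⟩
    have hcoe : Tendsto (fun p : ℕ+ × ℕ+ => ((p.1 : ℕ), (p.2 : ℕ))) atTop atTop := by
      rw [← prod_atTop_atTop_eq, ← prod_atTop_atTop_eq]
      exact tendsto_PNat_val_atTop_atTop.prodMap tendsto_PNat_val_atTop_atTop
    refine (hlim.comp (tendsto_range_product_range.comp hcoe)).congr fun p => ?_
    simp only [Function.comp_apply, rectPartialSum_eq, sq_abs, hφdef, hCdef]
  · obtain ⟨W, hW, hload⟩ := exists_weight_cesaro_le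
    have hQ : Tendsto (fun K : ℕ => Finset.range (K + 1) ×ˢ Finset.range (K + 1)) atTop atTop := by
      refine tendsto_range_product_range.comp
        (g := fun p : ℕ × ℕ => Finset.range p.1 ×ˢ Finset.range p.2)
        (f := fun K : ℕ => (K + 1, K + 1)) ?_
      rw [← prod_atTop_atTop_eq]
      exact (tendsto_add_atTop_nat 1).prodMk (tendsto_add_atTop_nat 1)
    -- Adding the tail majorant and |s_{K,K} - g|² lets a single K make both small at the same x.
    have hlim := ((tendsto_lintegral_doubleSquareSum_tail hφ hnorm horth hload (by norm_num)
      hC).comp hQ).add (isL2Sum_tendsto_diag hψ.memLp hg)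
    have hmeas : ∀ K : ℕ, AEMeasurable (fun x => doubleSquareSum W (fun p =>
        if p ∈ Finset.range (K + 1) ×ˢ Finset.range (K + 1) then 0 else C p * φ p x)) μ := by
      intro K
      refine aemeasurable_doubleSquareSum W
        (f := fun p x => if p ∈ Finset.range (K + 1) ×ˢ Finset.range (K + 1) then 0
          else C p * φ p x) fun p => ?_
      by_cases hp : p ∈ Finset.range (K + 1) ×ˢ Finset.range (K + 1)
      · simp only [hp, if_true]
        exact MemLp.zero'
      · simp only [hp, if_false]
        exact (hφ p).const_mul (C p)
    have hmeas' : ∀ K : ℕ, AEMeasurable (fun x => ENNReal.ofReal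
        ((∑ p ∈ Finset.range (K + 1) ×ˢ Finset.range (K + 1), C p * φ p x - g x) ^ 2)) μ :=
      fun K => (((memLp_finsetSum _ fun p _ => (hφ p).const_mul (C p)).sub
        hg.1).aestronglyMeasurable.aemeasurable.pow_const 2).ennreal_ofReal
    rw [add_zero] at hlim
    have hfreq := ae_frequently_lt_of_tendsto_lintegral_zero
      (fun K => (hmeas K).add (hmeas' K)) (hlim.congr fun K => (lintegral_add_left' (hmeas K) _).symm)
    filter_upwards [hfreq] with x hx
    rw [StronglyCesaroSummable, Metric.tendsto_atTop]
    intro ε hε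
    -- With ε/8 the final bound 7·ε/8 is strictly below ε.
    obtain ⟨K, hK⟩ := hx (ENNReal.ofReal (ε / 8)) (ENNReal.ofReal_pos.2 (by positivity))
    obtain ⟨M₀, hM₀⟩ := eventually_cesaro_le hW (by positivity) hK.le
    refine ⟨(M₀.succPNat, M₀.succPNat), fun P hP => ?_⟩
    have h1 : M₀ ≤ P.1 := (Nat.le_succ _).trans (PNat.coe_le_coe _ _ |>.2 hP.1)
    have h2 : M₀ ≤ P.2 := (Nat.le_succ _).trans (PNat.coe_le_coe _ _ |>.2 hP.2)
    have h := hM₀ P.1 P.2 h1 h2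
    rw [Real.dist_0_eq_abs, abs_of_nonneg (by positivity)]
    simp only [sum_Icc_one_pnat, rectPartialSum_eq, sq_abs, Nat.succPNat_coe, Nat.succ_eq_add_one]
    exact h.trans_lt (by linarith)
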